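/- A partition is called proper if none of its parts equals $1$ (the empty partition is proper). For a partition $\lambda$ let $|\lambda|$ be its size (the sum of its parts) and $l(\lambda)$ its number of parts. For a permutation $\omega$ of $\{1,\dots,2n\}$ let $\Gamma(\omega)$ be the graph on the vertex set $\{1,\dots,2n\}$ in which $i\neq j$ are joined by an exterior edge if $\{i,j\}=\{2k-1,2k\}$ for some $k$, and by an interior edge if $\{\omega(i),\omega(j)\}=\{2k-1,2k\}$ for some $k$. It is a disjoint union of cycles of even lengths $2\mu_1\ge 2\mu_2\ge\cdots$, and the partition $(\mu_1,\mu_2,\dots)$ of $n$ is the coset-type of $\omega$. For a proper partition $\lambda$ with $|\lambda|\le n$ let $K_\lambda(n)\in\mathbb{C}[\mathcal{S}_{2n}]$ be the sum of all permutations of coset-type $\lambda\cup(1^{n-|\lambda|})$. **Proposition.** Let $\lambda,\delta,\rho$ be proper partitions. For every $n\ge\max(|\lambda|,|\delta|)$ there are unique complex numbers $\alpha_{\lambda\delta}^{\tau}(n)$, indexed by the proper partitions $\tau$ with $|\tau|\le n$, such that $$K_\lambda(n)\cdot K_\delta(n)=\sum_{\tau\text{ proper},\ |\tau|\le n}\alpha_{\lambda\delta}^{\tau}(n)\,K_\tau(n);$$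 these are the structure coefficients of the Hecke algebra of the pair $(\mathcal{S}_{2n},\mathcal{B}_n)$. There is a unique polynomial $f_{\lambda\delta}^{\rho}\in\mathbb{Q}[X]$ such that $$\alpha_{\lambda\delta}^{\rho}(n)=2^n\,n!\,f_{\lambda\delta}^{\rho}(n)\qquad\text{for all integers } n\ge\max(|\lambda|,|\delta|,|\rho|)$$ and $$f_{\lambda\delta}^{\rho}(X)=\sum_{j=0}^{|\lambda|+|\delta|-|\rho|}a_j\,(X-|\rho|)_j$$ for some non-negative rational numbers $a_j$, where $(Y)_j=Y(Y-1)\cdots(Y-j+1)$ and an empty sum is $0$. Its degree satisfies $$\deg f_{\lambda\delta}^{\rho}\le|\lambda|+|\delta|-|\rho|\qquad\text{and}\qquad \deg f_{\lambda\delta}^{\rho}\le|\lambda|+|\delta|-|\rho|-l(\lambda)-l(\delta)+l(\rho),$$ where $\deg 0=-\infty$; in particular $f_{\lambda\delta}^{\rho}=0$ if one of the two bounds is negative. -/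

import Mathlib

open Polynomial

/-- A proper partition: a finite multiset of positive parts, none of which equals `1`. -/
@[ext]
structure ProperPartition where
  parts : Multiset ℕ
  two_le : ∀ i ∈ parts, 2 ≤ i

/-- The size `|lam|`, the sum of the parts. -/
def ProperPartition.size (lam : ProperPartition) : ℕ := lam.parts.sum

/-- The number of parts `l(lam)`. -/
def ProperPartition.length (lam : ProperPartition) : ℕ := Multiset.card lam.parts

/-- The graph `Γ(ω)` of a permutation `ω` of `2n` points. The points are numbered from `0`, so the
`k`-th pair is `{2k, 2k+1}`. Vertices `i`, `j` are joined by an exterior edge when `i`, `j` form a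
pair, and by an interior edge when `ω i`, `ω j` form a pair. (If both edges are present they are
recorded once; this changes no connected component.) -/
def cosetGraph {n : ℕ} (ω : Equiv.Perm (Fin (2 * n))) : SimpleGraph (Fin (2 * n)) where
  Adj i j := i ≠ j ∧
    ((i : ℕ) / 2 = (j : ℕ) / 2 ∨ ((ω i : Fin (2 * n)) : ℕ) / 2 = ((ω j : Fin (2 * n)) : ℕ) / 2)
  symm := ⟨fun _ _ h => ⟨h.1.symm, h.2.imp Eq.symm Eq.symm⟩⟩
  loopless := ⟨fun _ h => h.1 rfl⟩

open Classical in
/-- The coset-type of `ω`: the connected components of `Γ(ω)` are cycles, with `2μ₁, 2μ₂, …`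
vertices, and the coset-type is the partition `(μ₁, μ₂, …)` of `n`. -/
noncomputable def cosetType {n : ℕ} (ω : Equiv.Perm (Fin (2 * n))) : Multiset ℕ :=
  (Finset.univ : Finset (cosetGraph ω).ConnectedComponent).val.map fun C => C.supp.ncard / 2

open Classical in
/-- `K_lam(n)`: the sum, in the group algebra of the symmetric group on `2n` points, of all
permutations with coset-type `lam ∪ (1^(n - |lam|))`. It is meant for `|lam| ≤ n`. -/
noncomputable def heckeK (n : ℕ) (lam : ProperPartition) :
    MonoidAlgebra ℂ (Equiv.Perm (Fin (2 * n))) :=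
  ∑ ω ∈ Finset.univ.filter fun ω : Equiv.Perm (Fin (2 * n)) =>
      cosetType ω = lam.parts + Multiset.replicate (n - lam.size) 1,
    MonoidAlgebra.of ℂ (Equiv.Perm (Fin (2 * n))) ω

/-- `c` is a family of coefficients, indexed by the (finitely many) proper partitions `rho` with
`|rho| ≤ n` and extended by `0` to all other proper partitions, with
`K_lam(n) * K_del(n) = ∑ rho, c rho • K_rho(n)`. -/
def IsProductExpansion (lam del : ProperPartition) (n : ℕ) (c : ProperPartition →₀ ℂ) : Prop :=
  (∀ rho ∈ c.support, rho.size ≤ n) ∧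
    heckeK n lam * heckeK n del = c.sum fun rho a => a • heckeK n rho

/-- The structure coefficients `α_{lam,del}^{rho}(n)` of the Hecke algebra of `(S_{2n}, B_n)`,
as a function of `rho`. -/
noncomputable def structureCoeff (lam del : ProperPartition) (n : ℕ) : ProperPartition →₀ ℂ :=
  Classical.epsilon fun c => IsProductExpansion lam del n c

/-- `f` is the polynomial `f_{lam,del}^{rho}`: one has `α_{lam,del}^{rho}(n) = 2^n n! f(n)` for all
`n ≥ |rho|` for which `α_{lam,del}^{rho}(n)` is defined, and
`f = ∑_{0 ≤ j ≤ |lam| + |del| - |rho|} a_j (X - |rho|)_j` with non-negative rational `a_j`, where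
`(Y)_j = Y (Y - 1) ⋯ (Y - j + 1)`; the sum is empty if `|lam| + |del| < |rho|`. -/
def IsStructurePolynomial (lam del rho : ProperPartition) (f : ℚ[X]) : Prop :=
  (∀ n : ℕ, lam.size ≤ n → del.size ≤ n → rho.size ≤ n →
    structureCoeff lam del n rho = 2 ^ n * (n.factorial : ℂ) * ((f.eval (n : ℚ) : ℚ) : ℂ)) ∧
  ∃ a : ℕ → ℚ, (∀ j, 0 ≤ a j) ∧
    f = ∑ j ∈ Finset.range (lam.size + del.size + 1 - rho.size),
      C (a j) * (descPochhammer ℚ j).comp (X - C (rho.size : ℚ))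

/-! Let `p` be the base pairing, and attach to a permutation `ω` the pairing `ω p ω⁻¹`. The
coset-type of `ω` is the list of half-lengths of the loops formed by `ω p ω⁻¹` and `p`. With `r = ω
p ω⁻¹`, the coefficient of `ω` in `K_λ K_δ` counts the `a` for which `q = a p a⁻¹` forms loops of
type `λ` with `p` and of type `δ` with `r`, loops of half-length 1 being ignored. Each pairing `q`
comes from a coset of the centralizer of `p`, whence the factor `2^n n!` (`card_filter_conj_mem`).

Two pairs of pairings with the same loop type are simultaneously conjugate
(`exists_permCongr_of_loopType_eq`), so the coefficient depends only on the type `ρ` of `ω`, and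
`(p, r)` may be replaced by a fixed pair on `2|ρ|` points together with `n - |ρ|` common pairs.
Sorting the `q` by the set of common pairs they omit gives the count `∑ j, choose (n - |ρ|) j * c
j`, where `c j` does not depend on `n` (`card_middlePairings_flipExtend`). Hence `a j = c j / j!`.

If `c j ≠ 0`, some `q` on `2(|ρ| + j)` points omits all `j` common pairs. Every point then lies on a
nontrivial loop with `p` or with `r`, which gives the first degree bound. The second follows from a
triangle inequality for numbers of loops, sharpened by the common pairs of `p` and `r` missing from
`q` (`card_loopType_add_card_loopType_le`). -/

open Equiv (Perm)

/-- A permutation is a pairing if it is an involution without fixed points. -/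
def IsPairing {α : Type*} (p : Perm α) : Prop := p * p = 1 ∧ ∀ x, p x ≠ x

/-- The graph whose edges join `x` to `p x` and to `q x`. -/
def pairGraph {α : Type*} (p q : Perm α) : SimpleGraph α :=
  SimpleGraph.fromRel fun x y => p x = y ∨ q x = y

open Classical in
/-- The multiset of the half-sizes of the components of `pairGraph p q`. -/
noncomputable def loopType {α : Type*} [Fintype α] (p q : Perm α) : Multiset ℕ :=
  (Finset.univ : Finset (pairGraph p q).ConnectedComponent).val.map fun C => C.supp.ncard / 2

/-- The words in two involutions `p`, `q`, as permutations. -/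
def altWord {α : Type*} (p q : Perm α) (w : ℤ × Bool) : Perm α :=
  (if w.2 then p else 1) * (q * p) ^ w.1

/-! ### Loops of two pairings and the dihedral words that run through them -/

section

variable {α β : Type*} {p q r : Perm α}

namespace IsPairing

theorem apply_apply (hp : IsPairing p) (x : α) : p (p x) = x := by
  rw [← Equiv.Perm.mul_apply, hp.1, Equiv.Perm.one_apply]

theorem inv_eq (hp : IsPairing p) : p⁻¹ = p := inv_eq_of_mul_eq_one_left hp.1

theorem permCongr (hp : IsPairing p) (e : α ≃ β) : IsPairing (e.permCongr p) :=
  ⟨by ext x; simp [hp.apply_apply], fun x h =>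
    hp.2 (e.symm x) (by simpa [Equiv.symm_apply_eq, Equiv.eq_symm_apply] using h)⟩

theorem conj (hp : IsPairing p) (g : Perm α) : IsPairing (g * p * g⁻¹) := hp.permCongr g

end IsPairing

theorem pairGraph_comm (p q : Perm α) : pairGraph p q = pairGraph q p := by
  simp only [pairGraph, or_comm]

theorem loopType_comm [Fintype α] (p q : Perm α) : loopType p q = loopType q p := by
  rw [loopType, loopType, pairGraph_comm]

theorem pairGraph_reachable_left (p q : Perm α) (x : α) : (pairGraph p q).Reachable x (p x) := by
  by_cases h : x = p x
  · rw [← h]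
  · exact SimpleGraph.Adj.reachable (by simp [pairGraph, h])

theorem pairGraph_reachable_right (p q : Perm α) (x : α) : (pairGraph p q).Reachable x (q x) :=
  pairGraph_comm q p ▸ pairGraph_reachable_left q p x

/-- The values of `f` may be propositions or components of another graph; this is how reachability
is transported below. -/
theorem eq_of_pairGraph_reachable {ι : Type*} {f : α → ι} (hp : ∀ x, f (p x) = f x)
    (hq : ∀ x, f (q x) = f x) {x y : α} (h : (pairGraph p q).Reachable x y) : f x = f y := by
  obtain ⟨w⟩ := h
  induction w with
  | nil => rfl
  | cons h _ ih =>
    rw [← ih]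
    rw [pairGraph, SimpleGraph.fromRel_adj] at h
    rcases h.2 with (rfl | rfl) | (rfl | rfl)
    exacts [(hp _).symm, (hq _).symm, hp _, hq _]

open Classical in
theorem loopType_eq_of_label [Fintype α] {ι : Type*} [Fintype ι] {f : α → ι}
    (hf : Function.Surjective f)
    (h : ∀ x y, f x = f y ↔ (pairGraph p q).Reachable x y) :
    loopType p q = (Finset.univ : Finset ι).val.map fun i => {x | f x = i}.ncard / 2 := by
  let g : (pairGraph p q).ConnectedComponent → ι := Quot.lift f fun x y hxy => (h x y).2 hxy
  have hg : Function.Bijective g := by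
    constructor
    · rintro ⟨x⟩ ⟨y⟩ hxy
      exact Quot.sound ((h x y).1 hxy)
    · intro i
      obtain ⟨x, rfl⟩ := hf i
      exact ⟨Quot.mk _ x, rfl⟩
  rw [← Multiset.map_univ_val_equiv (Equiv.ofBijective g hg), Multiset.map_map, loopType]
  refine Multiset.map_congr rfl fun C _ => ?_
  simp only [Function.comp, Equiv.ofBijective_apply]
  congr 2
  ext x
  exact (hg.1.eq_iff (a := (pairGraph p q).connectedComponentMk x)).symm

theorem reachable_permCongr_iff (e : α ≃ β) (x y : α) :
    (pairGraph (e.permCongr p) (e.permCongr q)).Reachable (e x) (e y) ↔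
      (pairGraph p q).Reachable x y := by
  constructor
  · intro h
    have := eq_of_pairGraph_reachable
      (f := fun z => (pairGraph p q).connectedComponentMk (e.symm z)) ?_ ?_ h
    · simpa using this
    · intro z
      simpa using (pairGraph_reachable_left p q _).symm
    · intro z
      simpa using (pairGraph_reachable_right p q _).symm
  · intro h
    have := eq_of_pairGraph_reachable (f := fun z =>
      (pairGraph (e.permCongr p) (e.permCongr q)).connectedComponentMk (e z)) ?_ ?_ h
    · simpa using this
    · intro z
      simpa using (pairGraph_reachable_left (e.permCongr p) (e.permCongr q) (e z)).symm
    · intro z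
      simpa using (pairGraph_reachable_right (e.permCongr p) (e.permCongr q) (e z)).symm

theorem loopType_permCongr [Fintype α] [Fintype β] (e : α ≃ β) (p q : Perm α) :
    loopType (e.permCongr p) (e.permCongr q) = loopType p q := by
  classical
  rw [loopType_eq_of_label (p := e.permCongr p)
    (f := fun y => (pairGraph p q).connectedComponentMk (e.symm y)), loopType]
  · refine Multiset.map_congr rfl fun C _ => ?_
    rw [← Set.ncard_image_of_injective C.supp e.injective, Equiv.image_eq_preimage_symm]
    rfl
  · exact Quot.mk_surjective.comp e.symm.surjective
  · intro x y
    rw [SimpleGraph.ConnectedComponent.eq, ← reachable_permCongr_iff e]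
    simp

theorem loopType_conj [Fintype α] (g p q : Perm α) :
    loopType (g * p * g⁻¹) (g * q * g⁻¹) = loopType p q := loopType_permCongr g p q

theorem apply_altWord_left (hp : IsPairing p) (w : ℤ × Bool) (x : α) :
    p (altWord p q w x) = altWord p q (w.1, !w.2) x := by
  obtain ⟨i, _ | _⟩ := w <;> simp [altWord, hp.apply_apply]

/-- The dihedral relation: conjugation by the involution `p` inverts `q * p`. -/
theorem mul_zpow_eq (hp : IsPairing p) (hq : IsPairing q) (i : ℤ) :
    p * (q * p) ^ i = (q * p) ^ (-i) * p := by
  have h : SemiconjBy p (q * p) (q * p)⁻¹ := by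
    rw [SemiconjBy, mul_inv_rev, hp.inv_eq, hq.inv_eq, mul_assoc]
  have := h.zpow_right i
  rwa [inv_zpow', SemiconjBy] at this

theorem mul_left_zpow_eq (hp : IsPairing p) (hq : IsPairing q) (i : ℤ) :
    q * (q * p) ^ i = p * (q * p) ^ (i - 1) := by
  rw [mul_zpow_eq hp hq, neg_sub, sub_eq_add_neg, zpow_one_add, mul_assoc _ _ p,
    ← mul_zpow_eq hp hq, mul_assoc q, ← mul_assoc p, hp.1, one_mul]

theorem apply_altWord_right (hp : IsPairing p) (hq : IsPairing q) (w : ℤ × Bool) (x : α) :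
    q (altWord p q w x) = altWord p q (if w.2 then w.1 + 1 else w.1 - 1, !w.2) x := by
  obtain ⟨i, _ | _⟩ := w
  · simpa [altWord] using congrArg (· x) (mul_left_zpow_eq hp hq i)
  · simp [altWord, zpow_one_add, add_comm i 1]

theorem reachable_altWord (p q : Perm α) (w : ℤ × Bool) (x : α) :
    (pairGraph p q).Reachable x (altWord p q w x) := by
  obtain ⟨i, b⟩ := w
  have hs (y : α) : (pairGraph p q).Reachable y ((q * p) y) :=
    (pairGraph_reachable_left p q y).trans (pairGraph_reachable_right p q (p y))
  have h0 : (pairGraph p q).Reachable x (((q * p) ^ i) x) := by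
    induction i with
    | zero => simp
    | succ i ih =>
      rw [add_comm, zpow_one_add, Equiv.Perm.mul_apply]
      exact ih.trans (hs _)
    | pred i ih =>
      refine ih.trans ?_
      have := (hs (((q * p) ^ (-(i : ℤ) - 1)) x)).symm
      rwa [← Equiv.Perm.mul_apply, ← zpow_one_add, add_sub_cancel] at this
  cases b
  · simpa [altWord] using h0
  · simpa [altWord] using h0.trans (pairGraph_reachable_left p q _)

theorem reachable_iff_altWord (hp : IsPairing p) (hq : IsPairing q) {x y : α} :
    (pairGraph p q).Reachable x y ↔ ∃ w, altWord p q w x = y := by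
  constructor
  · intro h
    have := eq_of_pairGraph_reachable (p := p) (q := q)
      (f := fun z => ∃ w, altWord p q w x = z) ?_ ?_ h
    · rw [← this]
      exact ⟨(0, false), by simp [altWord]⟩
    · intro z
      refine propext ⟨?_, ?_⟩
      · rintro ⟨w, hw⟩
        exact ⟨_, by rw [← apply_altWord_left hp w, hw, hp.apply_apply]⟩
      · rintro ⟨w, rfl⟩
        exact ⟨_, (apply_altWord_left hp w x).symm⟩
    · intro z
      refine propext ⟨?_, ?_⟩
      · rintro ⟨w, hw⟩
        exact ⟨_, by rw [← apply_altWord_right hp hq w, hw, hq.apply_apply]⟩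
      · rintro ⟨w, rfl⟩
        exact ⟨_, (apply_altWord_right hp hq w x).symm⟩
  · rintro ⟨w, rfl⟩
    exact reachable_altWord p q w x

/-- A reflection of the dihedral group is conjugate to `p` or to `q`, according to the parity of
`i`, and so has no fixed point. -/
theorem mul_zpow_apply_ne (hp : IsPairing p) (hq : IsPairing q) (i : ℤ) (x : α) :
    p (((q * p) ^ i) x) ≠ x := by
  intro h
  rcases Int.even_or_odd' i with ⟨k, rfl | rfl⟩
  · apply hp.2 (((q * p) ^ k) x)
    rw [two_mul, zpow_add, ← Equiv.Perm.mul_apply, ← mul_assoc, mul_zpow_eq hp hq, zpow_neg,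
      mul_assoc, Equiv.Perm.mul_apply, Equiv.Perm.inv_eq_iff_eq] at h
    exact h
  · apply hq.2 (((q * p) ^ (k + 1)) x)
    rw [show 2 * k + 1 = k + (k + 1) by ring, zpow_add, ← Equiv.Perm.mul_apply, ← mul_assoc,
      mul_zpow_eq hp hq, zpow_neg, mul_assoc, Equiv.Perm.mul_apply, Equiv.Perm.inv_eq_iff_eq] at h
    have h' := congrArg p h
    rw [Equiv.Perm.mul_apply, hp.apply_apply] at h'
    nth_rw 2 [h']
    rw [add_comm k 1, zpow_one_add, Equiv.Perm.mul_apply, Equiv.Perm.mul_apply, hq.apply_apply]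

end

/-! ### Loop lengths and simultaneous conjugacy -/

section

variable {α β : Type*} {p q r : Perm α}

theorem altWord_apply_eq_iff_minimalPeriod (hp : IsPairing p) (hq : IsPairing q) (x : α)
    (w v : ℤ × Bool) : altWord p q w x = altWord p q v x ↔
      w.2 = v.2 ∧ (Function.minimalPeriod ((q * p) • ·) x : ℤ) ∣ w.1 - v.1 := by
  have key (i j : ℤ) : ((q * p) ^ i) x = ((q * p) ^ j) x ↔
      (Function.minimalPeriod ((q * p) • ·) x : ℤ) ∣ i - j := by
    rw [← MulAction.zpow_smul_eq_iff_minimalPeriod_dvd, Equiv.Perm.smul_def, sub_eq_neg_add,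
      zpow_add, Equiv.Perm.mul_apply, zpow_neg, Equiv.Perm.inv_eq_iff_eq]
  have key' (i j : ℤ) : p (((q * p) ^ i) x) ≠ ((q * p) ^ j) x := by
    intro h
    apply mul_zpow_apply_ne hp hq (i + j) x
    rw [← Equiv.Perm.mul_apply, mul_zpow_eq hp hq, neg_add, add_comm, zpow_add, mul_assoc,
      ← mul_zpow_eq hp hq, Equiv.Perm.mul_apply, Equiv.Perm.mul_apply, h,
      ← Equiv.Perm.mul_apply, ← zpow_add, neg_add_cancel, zpow_zero, Equiv.Perm.one_apply]
  obtain ⟨i, _ | _⟩ := w <;> obtain ⟨j, _ | _⟩ := v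
  · simp [altWord, key]
  · simpa [altWord] using (key' j i).symm
  · simpa [altWord] using (key' i j)
  · simp [altWord, key]

/-- The loop of `x` is the orbit of `x` under `q * p` together with its image under `p`. The two are
disjoint because reflections have no fixed points. -/
theorem ncard_supp_eq [Finite α] (hp : IsPairing p) (hq : IsPairing q) (x : α) :
    ((pairGraph p q).connectedComponentMk x).supp.ncard =
      2 * Function.minimalPeriod ((q * p) • ·) x := by
  classical
  have := Fintype.ofFinite α
  let O : Set α := MulAction.orbit (Subgroup.zpowers (q * p)) x
  have hO : O = Set.range fun i : ℤ => altWord p q (i, false) x := by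
    ext y
    simp only [O, MulAction.mem_orbit_iff, Subtype.exists, Subgroup.mem_zpowers_iff, Set.mem_range]
    constructor
    · rintro ⟨_, ⟨i, rfl⟩, rfl⟩
      exact ⟨i, by simp [altWord]⟩
    · rintro ⟨i, rfl⟩
      exact ⟨_, ⟨i, rfl⟩, by simp [altWord]⟩
  have hpO : p '' O = Set.range fun i : ℤ => altWord p q (i, true) x := by
    rw [hO, ← Set.range_comp]
    exact congrArg Set.range (funext fun i => apply_altWord_left hp _ _)
  have hsupp : ((pairGraph p q).connectedComponentMk x).supp = O ∪ p '' O := by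
    ext y
    rw [SimpleGraph.ConnectedComponent.mem_supp_iff, SimpleGraph.ConnectedComponent.eq,
      SimpleGraph.reachable_comm, reachable_iff_altWord hp hq, hpO, hO]
    simp [exists_or]
  have hdisj : Disjoint O (p '' O) := by
    rw [hpO, hO, Set.disjoint_left]
    rintro _ ⟨i, rfl⟩ ⟨j, hj⟩
    simpa using ((altWord_apply_eq_iff_minimalPeriod hp hq x _ _).1 hj).1
  rw [hsupp, Set.ncard_union_eq hdisj, Set.ncard_image_of_injective _ p.injective, ← two_mul,
    MulAction.minimalPeriod_eq_card, Set.ncard_eq_toFinset_card', Set.toFinset_card]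

theorem altWord_apply_eq_iff [Finite α] (hp : IsPairing p) (hq : IsPairing q) (x : α)
    (w v : ℤ × Bool) : altWord p q w x = altWord p q v x ↔
      w.2 = v.2 ∧
        ((((pairGraph p q).connectedComponentMk x).supp.ncard / 2 : ℕ) : ℤ) ∣ w.1 - v.1 := by
  rw [altWord_apply_eq_iff_minimalPeriod hp hq, ncard_supp_eq hp hq,
    Nat.mul_div_cancel_left _ two_pos]

theorem even_ncard_supp [Finite α] (hp : IsPairing p) (hq : IsPairing q)
    (C : (pairGraph p q).ConnectedComponent) : 2 * (C.supp.ncard / 2) = C.supp.ncard := by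
  induction C using SimpleGraph.ConnectedComponent.ind with
  | h x => rw [ncard_supp_eq hp hq, Nat.mul_div_cancel_left _ two_pos]

theorem permCongr_eq_of_apply {p' : Perm β} {e : α ≃ β} (h : ∀ x, e (p x) = p' (e x)) :
    e.permCongr p = p' := by
  ext y
  rw [Equiv.permCongr_apply, h, e.apply_symm_apply]

/-- Two pairs of pairings with the same loop type are simultaneously conjugate. -/
theorem exists_permCongr_of_loopType_eq [Fintype α] [Fintype β] {p' q' : Perm β}
    (hp : IsPairing p) (hq : IsPairing q) (hp' : IsPairing p') (hq' : IsPairing q')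
    (h : loopType p q = loopType p' q') :
    ∃ e : α ≃ β, e.permCongr p = p' ∧ e.permCongr q = q' := by
  classical
  let s (C : (pairGraph p q).ConnectedComponent) : ℕ := C.supp.ncard / 2
  let s' (C : (pairGraph p' q').ConnectedComponent) : ℕ := C.supp.ncard / 2
  have hcard (c : ℕ) : Fintype.card {C // s C = c} = Fintype.card {C // s' C = c} := by
    have := congrArg (Multiset.count c) h
    rw [loopType, loopType, Multiset.count_map, Multiset.count_map] at this
    rw [Fintype.card_subtype, Fintype.card_subtype]
    simpa [eq_comm, Finset.card_def, Finset.filter_val, s, s'] using this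
  -- Equally many loops of each size give a size-preserving bijection of loops.
  let φ := Equiv.ofFiberEquiv fun c => Fintype.equivOfCardEq (hcard c)
  have hφ (C) : (φ C).supp.ncard / 2 = C.supp.ncard / 2 :=
    Equiv.ofFiberEquiv_map (f := s) (g := s') _ C
  have hwx (x : α) : ∃ w, altWord p q w ((pairGraph p q).connectedComponentMk x).out = x :=
    (reachable_iff_altWord hp hq).1 (SimpleGraph.ConnectedComponent.exact (Quot.out_eq _))
  choose w hw using hwx
  -- A point reached by a word from the base point of its loop goes to the point reached by the same
  -- word in the matched loop. The choice of word is immaterial, since coincidences of words depend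
  -- only on the size of the loop.
  let f (x : α) : β := altWord p' q' (w x) (φ ((pairGraph p q).connectedComponentMk x)).out
  have hf (C : (pairGraph p q).ConnectedComponent) (v : ℤ × Bool) :
      f (altWord p q v C.out) = altWord p' q' v (φ C).out := by
    have hC : (pairGraph p q).connectedComponentMk (altWord p q v C.out) = C := by
      rw [← SimpleGraph.ConnectedComponent.sound (reachable_altWord p q v C.out)]
      exact Quot.out_eq C
    have h1 := hw (altWord p q v C.out)
    simp only [f]
    rw [hC] at h1 ⊢
    rw [altWord_apply_eq_iff hp hq] at h1
    rw [altWord_apply_eq_iff hp' hq']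
    refine ⟨h1.1, ?_⟩
    have e1 : (pairGraph p q).connectedComponentMk C.out = C := Quot.out_eq C
    have e2 : (pairGraph p' q').connectedComponentMk (φ C).out = φ C := Quot.out_eq _
    rw [e2, hφ]
    rw [e1] at h1
    exact h1.2
  have hrep (x : α) : ∃ C : (pairGraph p q).ConnectedComponent, ∃ v, x = altWord p q v C.out :=
    ⟨_, _, (hw x).symm⟩
  have hfp (x : α) : f (p x) = p' (f x) := by
    obtain ⟨C, v, rfl⟩ := hrep x
    rw [apply_altWord_left hp, hf, hf, apply_altWord_left hp']
  have hfq (x : α) : f (q x) = q' (f x) := by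
    obtain ⟨C, v, rfl⟩ := hrep x
    rw [apply_altWord_right hp hq, hf, hf, apply_altWord_right hp' hq']
  have hcomp (C : (pairGraph p q).ConnectedComponent) (v : ℤ × Bool) :
      (pairGraph p' q').connectedComponentMk (f (altWord p q v C.out)) = φ C := by
    rw [hf, ← SimpleGraph.ConnectedComponent.sound (reachable_altWord p' q' v (φ C).out)]
    exact Quot.out_eq _
  have hinj : Function.Injective f := by
    intro x y hxy
    obtain ⟨C, v, rfl⟩ := hrep x
    obtain ⟨D, u, rfl⟩ := hrep y
    have hCD := congrArg (pairGraph p' q').connectedComponentMk hxy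
    rw [hcomp, hcomp, φ.apply_eq_iff_eq] at hCD
    subst hCD
    rw [hf, hf, altWord_apply_eq_iff hp' hq'] at hxy
    rw [altWord_apply_eq_iff hp hq]
    refine ⟨hxy.1, ?_⟩
    have e1 : (pairGraph p q).connectedComponentMk C.out = C := Quot.out_eq C
    have e2 : (pairGraph p' q').connectedComponentMk (φ C).out = φ C := Quot.out_eq _
    rw [e1]
    rw [e2, hφ] at hxy
    exact hxy.2
  have hsurj : Function.Surjective f := by
    intro y
    have e2 : (pairGraph p' q').Reachable ((pairGraph p' q').connectedComponentMk y).out y :=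
      SimpleGraph.ConnectedComponent.exact (Quot.out_eq _)
    obtain ⟨v, hv⟩ := (reachable_iff_altWord hp' hq').1 e2
    refine ⟨altWord p q v (φ.symm ((pairGraph p' q').connectedComponentMk y)).out, ?_⟩
    rw [hf, φ.apply_symm_apply, hv]
  exact ⟨Equiv.ofBijective f ⟨hinj, hsurj⟩, permCongr_eq_of_apply hfp, permCongr_eq_of_apply hfq⟩

end

/-! ### Statistics of loop types, and their realization -/

section

variable {α β : Type*} {p q r : Perm α}

theorem mem_loopType [Fintype α] (hp : IsPairing p) (hq : IsPairing q) {i : ℕ} :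
    i ∈ loopType p q ↔ ∃ x : α, Function.minimalPeriod ((q * p) • ·) x = i := by
  simp only [loopType, Multiset.mem_map, Finset.mem_val, Finset.mem_univ, true_and]
  constructor
  · rintro ⟨C, rfl⟩
    induction C using SimpleGraph.ConnectedComponent.ind with
    | h x => exact ⟨x, by rw [ncard_supp_eq hp hq, Nat.mul_div_cancel_left _ two_pos]⟩
  · rintro ⟨x, rfl⟩
    exact ⟨_, by rw [ncard_supp_eq hp hq x, Nat.mul_div_cancel_left _ two_pos]⟩

theorem minimalPeriod_eq_one_iff (hq : IsPairing q) {x : α} :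
    Function.minimalPeriod ((q * p) • ·) x = 1 ↔ p x = q x := by
  rw [Function.minimalPeriod_eq_one_iff_isFixedPt, Function.IsFixedPt, Equiv.Perm.smul_def,
    Equiv.Perm.mul_apply]
  nth_rw 2 [← hq.apply_apply x]
  rw [q.apply_eq_iff_eq]

theorem pos_of_mem_loopType [Fintype α] (hp : IsPairing p) (hq : IsPairing q) {i : ℕ}
    (hi : i ∈ loopType p q) : 0 < i := by
  obtain ⟨x, rfl⟩ := (mem_loopType hp hq).1 hi
  exact Function.minimalPeriod_pos_of_mem_periodicPts
    ((MulAction.injective (q * p)).mem_periodicPts x)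

theorem eq_one_of_mem_loopType_self [Fintype α] (hp : IsPairing p) {i : ℕ}
    (hi : i ∈ loopType p p) : i = 1 := by
  obtain ⟨x, rfl⟩ := (mem_loopType hp hp).1 hi
  exact (minimalPeriod_eq_one_iff hp).2 rfl

/-- A part `i` stands for a loop of `2 * i` points, all of period `i` under `q * p`. -/
theorem two_mul_sum_filter_loopType [Fintype α] (hp : IsPairing p) (hq : IsPairing q)
    (P : ℕ → Prop) [DecidablePred P] : 2 * ((loopType p q).filter P).sum =
      ({x | P (Function.minimalPeriod ((q * p) • ·) x)} : Finset α).card := by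
  classical
  rw [Finset.card_eq_sum_card_fiberwise (f := (pairGraph p q).connectedComponentMk)
    (t := {C | P (C.supp.ncard / 2)}), loopType, Multiset.filter_map, ← Finset.filter_val]
  · change 2 * Finset.sum _ _ = _
    rw [Finset.mul_sum]
    refine Finset.sum_congr rfl fun C hC => ?_
    rw [even_ncard_supp hp hq, ← Set.ncard_coe_finset]
    congr 1
    ext x
    simp only [Finset.mem_filter, Finset.mem_univ, true_and] at hC
    simp only [SimpleGraph.ConnectedComponent.mem_supp_iff, Finset.coe_filter, Finset.mem_filter,
      Finset.mem_univ, true_and, Set.mem_ofPred_eq, iff_and_self]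
    rintro rfl
    rwa [ncard_supp_eq hp hq, Nat.mul_div_cancel_left _ two_pos] at hC
  · intro x hx
    simpa [ncard_supp_eq hp hq] using (Finset.mem_filter.1 hx).2

theorem two_mul_sum_loopType [Fintype α] (hp : IsPairing p) (hq : IsPairing q) :
    2 * (loopType p q).sum = Fintype.card α := by
  have := two_mul_sum_filter_loopType hp hq fun _ => True
  rw [Multiset.filter_eq_self.2 fun _ _ => trivial] at this
  simpa using this

theorem two_mul_sum_filter_ne_one_loopType [Fintype α] [DecidableEq α] (hp : IsPairing p)
    (hq : IsPairing q) : 2 * ((loopType p q).filter (· ≠ 1)).sum =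
      ({x | p x ≠ q x} : Finset α).card := by
  have := two_mul_sum_filter_loopType hp hq (· ≠ 1)
  simp only [ne_eq, minimalPeriod_eq_one_iff hq] at this
  convert this

theorem loopType_sumCongr [Fintype α] [Fintype β] (p q : Perm α) (p' q' : Perm β) :
    loopType (Equiv.Perm.sumCongr p p') (Equiv.Perm.sumCongr q q') =
      loopType p q + loopType p' q' := by
  classical
  let f : α ⊕ β → (pairGraph p q).ConnectedComponent ⊕ (pairGraph p' q').ConnectedComponent :=
    Sum.map (pairGraph p q).connectedComponentMk (pairGraph p' q').connectedComponentMk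
  set P := Equiv.Perm.sumCongr p p' with hP
  set Q := Equiv.Perm.sumCongr q q' with hQ
  have hf : Function.Surjective f :=
    Function.Surjective.sumMap Quot.mk_surjective Quot.mk_surjective
  have hl (x y) (h : (pairGraph p q).Reachable x y) :
      (pairGraph P Q).connectedComponentMk (Sum.inl x) =
        (pairGraph P Q).connectedComponentMk (Sum.inl y) := by
    refine eq_of_pairGraph_reachable
      (f := fun z => (pairGraph P Q).connectedComponentMk (Sum.inl z)) ?_ ?_ h
    · exact fun z => (SimpleGraph.ConnectedComponent.sound
        (pairGraph_reachable_left P Q (Sum.inl z))).symm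
    · exact fun z => (SimpleGraph.ConnectedComponent.sound
        (pairGraph_reachable_right P Q (Sum.inl z))).symm
  have hr (x y) (h : (pairGraph p' q').Reachable x y) :
      (pairGraph P Q).connectedComponentMk (Sum.inr x) =
        (pairGraph P Q).connectedComponentMk (Sum.inr y) := by
    refine eq_of_pairGraph_reachable
      (f := fun z => (pairGraph P Q).connectedComponentMk (Sum.inr z)) ?_ ?_ h
    · exact fun z => (SimpleGraph.ConnectedComponent.sound
        (pairGraph_reachable_left P Q (Sum.inr z))).symm
    · exact fun z => (SimpleGraph.ConnectedComponent.sound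
        (pairGraph_reachable_right P Q (Sum.inr z))).symm
  rw [loopType_eq_of_label hf, ← Finset.univ_disjSum_univ, Finset.val_disjSum, Multiset.disjSum,
    Multiset.map_add, Multiset.map_map, Multiset.map_map, loopType, loopType]
  · congr 1
    · refine Multiset.map_congr rfl fun C _ => ?_
      rw [← Set.ncard_image_of_injective C.supp (Sum.inl_injective (β := β))]
      simp only [Function.comp]
      congr 2
      ext (x | x) <;> simp [f]
    · refine Multiset.map_congr rfl fun C _ => ?_
      rw [← Set.ncard_image_of_injective C.supp (Sum.inr_injective (α := α))]
      simp only [Function.comp]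
      congr 2
      ext (x | x) <;> simp [f]
  · intro x y
    constructor
    · intro h
      rcases x with x | x <;> rcases y with y | y <;> simp [f] at h
      · exact SimpleGraph.ConnectedComponent.exact (hl x y h)
      · exact SimpleGraph.ConnectedComponent.exact (hr x y h)
    · refine eq_of_pairGraph_reachable ?_ ?_
      · rintro (x | x)
        · simpa [f, hP] using (pairGraph_reachable_left p q x).symm
        · simpa [f, hP] using (pairGraph_reachable_left p' q' x).symm
      · rintro (x | x)
        · simpa [f, hQ] using (pairGraph_reachable_right p q x).symm
        · simpa [f, hQ] using (pairGraph_reachable_right p' q' x).symm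

theorem IsPairing.sumCongr {p' : Perm β} (hp : IsPairing p) (hp' : IsPairing p') :
    IsPairing (Equiv.Perm.sumCongr p p') := by
  constructor
  · ext (x | x) <;> simp [hp.apply_apply, hp'.apply_apply]
  · rintro (x | x) <;> simp [hp.2, hp'.2]

/-- The pairing of `(i, false)` with `(i, true)`. -/
def flipPerm (ι : Type*) : Perm (ι × Bool) := Equiv.prodCongrRight fun _ => Equiv.boolNot

theorem flipPerm_apply {ι : Type*} (x : ι × Bool) : flipPerm ι x = (x.1, !x.2) := rfl

theorem isPairing_flipPerm (ι : Type*) : IsPairing (flipPerm ι) :=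
  ⟨by ext x <;> simp [flipPerm_apply], fun x h => by
    simpa [flipPerm_apply] using congrArg Prod.snd h⟩

theorem exists_loopType_singleton (m : ℕ) [NeZero m] :
    ∃ p q : Perm (ZMod m × Bool), IsPairing p ∧ IsPairing q ∧ loopType p q = {m} := by
  -- With the flip of the second coordinate this closes up to one cycle of `2 * m` points, since
  -- `(i, true)` is joined to `(i + 1, false)`; for `m = 1` both pairings agree.
  let g : ZMod m × Bool → ZMod m × Bool := fun x => (if x.2 then x.1 + 1 else x.1 - 1, !x.2)
  have hg : Function.Involutive g := by
    rintro ⟨i, _ | _⟩ <;> simp [g]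
  let q : Perm (ZMod m × Bool) := hg.toPerm
  have hq : IsPairing q :=
    ⟨by ext x : 1; exact hg x, fun x h => by simpa [q, g] using congrArg Prod.snd h⟩
  refine ⟨flipPerm _, q, isPairing_flipPerm _, hq, ?_⟩
  have h0 (k : ℕ) : (pairGraph (flipPerm _) q).Reachable (0, false) ((k : ZMod m), false) := by
    induction k with
    | zero => simp
    | succ k ih =>
      have h1 := pairGraph_reachable_left (flipPerm _) q ((k : ZMod m), false)
      have h2 := pairGraph_reachable_right (flipPerm _) q ((k : ZMod m), true)
      have h3 : q ((k : ZMod m), true) = (((k + 1 : ℕ) : ZMod m), false) := by simp [q, g]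
      rw [h3] at h2
      exact (ih.trans h1).trans h2
  have h1 (x : ZMod m × Bool) : (pairGraph (flipPerm _) q).Reachable (0, false) x := by
    obtain ⟨i, b⟩ := x
    have h2 := h0 i.val
    rw [ZMod.natCast_zmod_val] at h2
    cases b
    · exact h2
    · exact h2.trans (pairGraph_reachable_left (flipPerm _) q (i, false))
  rw [loopType_eq_of_label (f := fun _ => ()) (fun _ => ⟨0, rfl⟩)
    fun x y => ⟨fun _ => (h1 x).symm.trans (h1 y), fun _ => rfl⟩]
  simp [Set.ncard_univ, ZMod.card]

theorem exists_loopType_eq (s : Multiset ℕ) (hs : ∀ i ∈ s, 0 < i) :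
    ∃ (α : Type) (_ : Fintype α) (p q : Perm α), IsPairing p ∧ IsPairing q ∧ loopType p q = s := by
  induction s using Multiset.induction with
  | empty =>
    refine ⟨Empty, inferInstance, 1, 1, ⟨rfl, fun x => x.elim⟩, ⟨rfl, fun x => x.elim⟩, ?_⟩
    rw [loopType_eq_of_label (ι := Empty) (f := fun x => x) (fun x => x.elim) (fun x => x.elim)]
    rfl
  | cons m s ih =>
    obtain ⟨α, _, p, q, hp, hq, h⟩ := ih fun i hi => hs i (Multiset.mem_cons_of_mem hi)
    have : NeZero m := ⟨(hs m (Multiset.mem_cons_self _ _)).ne'⟩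
    obtain ⟨p', q', hp', hq', h'⟩ := exists_loopType_singleton m
    refine ⟨_, inferInstance, _, _, hp'.sumCongr hp, hq'.sumCongr hq, ?_⟩
    rw [loopType_sumCongr, h, h', Multiset.singleton_add]

end

/-! ### The triangle inequality for numbers of loops -/

section

variable {α : Type*} {p q r : Perm α}

/-- The real functions invariant under `p` and `q`. -/
def invariantFunctions (p q : Perm α) : Submodule ℝ (α → ℝ) where
  carrier := {f | ∀ x, f (p x) = f x ∧ f (q x) = f x}
  add_mem' hf hg x := by simp [(hf x).1, (hf x).2, (hg x).1, (hg x).2]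
  zero_mem' x := by simp
  smul_mem' c f hf x := by simp [(hf x).1, (hf x).2]

/-- Invariant functions are those constant on loops, that is, the kernel of the Laplacian. Loop
counts can thus be compared through dimensions. -/
theorem finrank_invariantFunctions [Fintype α] (p q : Perm α) :
    Module.finrank ℝ (invariantFunctions p q) = Multiset.card (loopType p q) := by
  classical
  have h : invariantFunctions p q =
      LinearMap.ker (Matrix.toLin' ((pairGraph p q).lapMatrix ℝ)) := by
    ext f
    rw [LinearMap.mem_ker, Matrix.toLin'_apply,
      SimpleGraph.lapMatrix_mulVec_eq_zero_iff_forall_reachable]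
    constructor
    · exact fun hf x y => eq_of_pairGraph_reachable (fun z => (hf z).1) (fun z => (hf z).2)
    · exact fun hf x => ⟨(hf _ _ (pairGraph_reachable_left p q x)).symm,
        (hf _ _ (pairGraph_reachable_right p q x)).symm⟩
  rw [h, ← SimpleGraph.card_connectedComponent_eq_finrank_ker_toLin'_lapMatrix, loopType,
    Multiset.card_map, Finset.card_val, Finset.card_univ]

theorem finrank_le_finrank_inf_ker_add_one [Fintype α] (W : Submodule ℝ (α → ℝ))
    (φ : (α → ℝ) →ₗ[ℝ] ℝ) :
    Module.finrank ℝ W ≤ Module.finrank ℝ (W ⊓ LinearMap.ker φ : Submodule ℝ (α → ℝ)) + 1 := by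
  have h1 := Submodule.finrank_sup_add_finrank_inf_eq W (LinearMap.ker φ)
  have h2 := φ.finrank_range_add_finrank_ker
  have h3 := Submodule.finrank_le (W ⊔ LinearMap.ker φ)
  have h4 := Submodule.finrank_le (LinearMap.range φ)
  rw [Module.finrank_self] at h4
  omega

/-- An invariant function with equal values at `y` and `u` stays invariant after the conjugation,
and that condition is a single linear equation. -/
theorem card_loopType_le_conj_swap_add_one [Fintype α] [DecidableEq α] (q r : Perm α) (y u : α) :
    Multiset.card (loopType q r) ≤
      Multiset.card (loopType (Equiv.swap y u * q * (Equiv.swap y u)⁻¹) r) + 1 := by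
  rw [← finrank_invariantFunctions, ← finrank_invariantFunctions]
  refine (finrank_le_finrank_inf_ker_add_one _
    (LinearMap.proj (R := ℝ) (φ := fun _ : α => ℝ) y - LinearMap.proj u)).trans ?_
  refine Nat.add_le_add_right (Submodule.finrank_mono ?_) 1
  rintro f ⟨hf, hyu⟩ x
  have hyu : f y = f u := by simpa [sub_eq_zero] using hyu
  have hs (z : α) : f (Equiv.swap y u z) = f z := by
    rw [Equiv.swap_apply_def]
    split_ifs with h1 h2
    · rw [h1, hyu]
    · rw [h2, hyu]
    · rfl
  refine ⟨?_, (hf x).2⟩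
  rw [Equiv.Perm.mul_apply, Equiv.Perm.mul_apply, hs, (hf _).1, Equiv.swap_inv, hs]

/-- The pairing `q`, changed so that `x` is paired with `p x` and `q x` with `q (p x)`. -/
def switch [DecidableEq α] (p q : Perm α) (x : α) : Perm α :=
  Equiv.swap (p x) (q x) * q * (Equiv.swap (p x) (q x))⁻¹

theorem switch_apply_self [DecidableEq α] (hp : IsPairing p) (hq : IsPairing q) (x : α) :
    switch p q x x = p x := by
  rw [switch, Equiv.Perm.mul_apply, Equiv.Perm.mul_apply, Equiv.swap_inv,
    Equiv.swap_apply_of_ne_of_ne (hp.2 x).symm (hq.2 x).symm, Equiv.swap_apply_right]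

theorem switch_apply_of_ne [DecidableEq α] (hq : IsPairing q) {x z : α}
    (h1 : z ≠ x) (h2 : z ≠ p x) (h3 : z ≠ q x) (h4 : z ≠ q (p x)) :
    switch p q x z = q z := by
  rw [switch, Equiv.Perm.mul_apply, Equiv.Perm.mul_apply, Equiv.swap_inv,
    Equiv.swap_apply_of_ne_of_ne h2 h3, Equiv.swap_apply_of_ne_of_ne]
  · rintro h
    exact h4 (by rw [← h, hq.apply_apply])
  · rintro h
    exact h1 (q.injective h)

theorem card_loopType_switch [Fintype α] [DecidableEq α] (hp : IsPairing p) (hq : IsPairing q)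
    {x : α} (hx : p x ≠ q x) :
    Multiset.card (loopType p q) + 1 ≤ Multiset.card (loopType p (switch p q x)) := by
  rw [← finrank_invariantFunctions, ← finrank_invariantFunctions, Nat.succ_le_iff]
  have hs : IsPairing (switch p q x) := hq.conj _
  apply Submodule.finrank_lt_finrank_of_lt
  refine lt_of_le_of_ne ?_ ?_
  · intro f hf z
    refine ⟨(hf z).1, ?_⟩
    have hyu : f (p x) = f (q x) := by rw [(hf x).1, (hf x).2]
    have hsw (z : α) : f (Equiv.swap (p x) (q x) z) = f z := by
      rw [Equiv.swap_apply_def]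
      split_ifs with h1 h2
      · rw [h1, hyu]
      · rw [h2, hyu]
      · rfl
    rw [switch, Equiv.Perm.mul_apply, Equiv.Perm.mul_apply, hsw, (hf _).2, Equiv.swap_inv, hsw]
  · intro h
    -- The inclusion is strict: after the switch `{x, p x}` is a loop, and its indicator is not
    -- invariant under `q`.
    let f : α → ℝ := fun z => if z = x ∨ z = p x then 1 else 0
    have hpx (g : Perm α) (hg : IsPairing g) (hgx : g x = p x) (z : α) :
        f (g z) = f z := by
      have h1 : g z = x ↔ z = p x := by
        rw [← hgx]
        exact ⟨fun h => by rw [← h, hg.apply_apply], fun h => by rw [h, hg.apply_apply]⟩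
      have h2 : g z = p x ↔ z = x := by rw [← hgx, g.apply_eq_iff_eq]
      simp only [f, h1, h2, or_comm]
    have hf : f ∈ invariantFunctions p (switch p q x) := fun z =>
      ⟨hpx p hp rfl z, hpx _ hs (switch_apply_self hp hq x) z⟩
    rw [← h] at hf
    have := (hf x).2
    simp [f, hq.2 x, hx.symm] at this

theorem two_mul_card_loopType_le [Fintype α] (hp : IsPairing p) (hq : IsPairing q) :
    2 * Multiset.card (loopType p q) ≤ Fintype.card α := by
  rw [← two_mul_sum_loopType hp hq]
  refine Nat.mul_le_mul_left 2 ?_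
  have := Multiset.card_nsmul_le_sum (s := loopType p q) (a := 1)
    fun i hi => pos_of_mem_loopType hp hq hi
  simpa using this

/-- A sharpened triangle inequality for the numbers of loops of three pairings. -/
theorem card_loopType_add_card_loopType_le [Fintype α] [DecidableEq α] (hp : IsPairing p)
    (hq : IsPairing q) (hr : IsPairing r) :
    2 * Multiset.card (loopType p q) + 2 * Multiset.card (loopType q r) +
        ({x | p x = r x ∧ p x ≠ q x} : Finset α).card ≤
      2 * Multiset.card (loopType p r) + Fintype.card α := by
  induction hn : ({x | p x ≠ q x} : Finset α).card using Nat.strong_induction_on generalizing q with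
  | _ n ih =>
    subst hn
    by_cases hpq : p = q
    · subst hpq
      have := two_mul_card_loopType_le hp hp
      simp only [ne_eq, not_true_eq_false, and_false, Finset.filter_false, Finset.card_empty]
      omega
    -- A switch towards `p` creates no new disagreement with `p` and removes the one at `x`; this
    -- drives the induction.
    have step (x : α) (hx : p x ≠ q x) :
        (∀ z, p z ≠ switch p q x z → p z ≠ q z) ∧
        ({z | p z ≠ switch p q x z} : Finset α).card < ({z | p z ≠ q z} : Finset α).card := by
      have h1 (z) (hz : p z ≠ switch p q x z) : p z ≠ q z := by
        intro h
        by_cases h1 : z = x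
        · exact hx (h1 ▸ h)
        by_cases h2 : z = p x
        · subst h2
          rw [hp.apply_apply] at h
          exact hx (by nth_rw 2 [h]; rw [hq.apply_apply])
        by_cases h3 : z = q x
        · subst h3
          rw [hq.apply_apply] at h
          exact hx (by nth_rw 1 [← h]; rw [hp.apply_apply])
        by_cases h4 : z = q (p x)
        · subst h4
          rw [hq.apply_apply, p.apply_eq_iff_eq] at h
          exact hx (by nth_rw 2 [← h]; rw [hq.apply_apply])
        exact hz (by rw [switch_apply_of_ne hq h1 h2 h3 h4, h])
      refine ⟨h1, Finset.card_lt_card (Finset.ssubset_iff_of_subset ?_ |>.2 ⟨x, ?_, ?_⟩)⟩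
      · intro z hz
        simpa using h1 z (by simpa using hz)
      · simpa using hx
      · simp [switch_apply_self hp hq]
    -- At a pair common to `p` and `r` the switch adds a loop with both, raising the left side by at
    -- least 4, while at most the 4 points involved leave the counted set. Otherwise that set is
    -- empty, and any switch gains a loop with `p` and loses at most one with `r`.
    by_cases hD : ∃ x, p x = r x ∧ p x ≠ q x
    · obtain ⟨x, hxr, hxq⟩ := hD
      have hs : IsPairing (switch p q x) := hq.conj _
      have key := ih _ (step x hxq).2 hs rfl
      have h1 := card_loopType_switch hp hq hxq
      have h2 := card_loopType_switch hr hq (x := x) (hxr ▸ hxq)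
      have h3 : switch r q x = switch p q x := by rw [switch, switch, hxr]
      rw [h3, loopType_comm, loopType_comm r] at h2
      have h4 : ({z | p z = r z ∧ p z ≠ q z} : Finset α) ⊆
          ({z | p z = r z ∧ p z ≠ switch p q x z} : Finset α) ∪ {x, p x, q x, q (p x)} := by
        intro z hz
        by_contra hz'
        simp only [Finset.mem_union, Finset.mem_filter, Finset.mem_univ, true_and,
          Finset.mem_insert, Finset.mem_singleton, not_or] at hz hz'
        obtain ⟨h0, h1, h2, h3, h4⟩ := hz'
        rw [switch_apply_of_ne hq h1 h2 h3 h4] at h0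
        exact h0 hz
      have h5 := (Finset.card_le_card h4).trans (Finset.card_union_le _ _)
      have h6 : ({x, p x, q x, q (p x)} : Finset α).card ≤ 4 := Finset.card_le_four
      omega
    · obtain ⟨x, hx⟩ : ∃ x, p x ≠ q x := by
        by_contra! h
        exact hpq (Equiv.ext h)
      have hs : IsPairing (switch p q x) := hq.conj _
      have key := ih _ (step x hx).2 hs rfl
      have h1 := card_loopType_switch hp hq hx
      have h2 := card_loopType_le_conj_swap_add_one q r (p x) (q x)
      rw [← switch] at h2
      have h3 : ({x | p x = r x ∧ p x ≠ q x} : Finset α) = ∅ := by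
        ext z
        simpa using fun h1 h2 => hD ⟨z, h1, h2⟩
      rw [h3, Finset.card_empty]
      omega

end

/-! ### Counting the middle pairings over an enlarged set of points -/

section

variable {α β : Type*} {p q r : Perm α}

theorem sum_add_card_filter_ne_one (s : Multiset ℕ) :
    s.sum + Multiset.card (s.filter (· ≠ 1)) = (s.filter (· ≠ 1)).sum + Multiset.card s := by
  induction s using Multiset.induction with
  | empty => rfl
  | cons a s ih =>
    by_cases h : a = 1
    · simp only [h, ne_eq, not_true_eq_false, not_false_eq_true, Multiset.filter_cons_of_neg,
        Multiset.sum_cons, Multiset.card_cons] at ih ⊢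
      omega
    · simp only [ne_eq, h, not_false_eq_true, Multiset.filter_cons_of_pos,
        Multiset.sum_cons, Multiset.card_cons] at ih ⊢
      omega

open Classical in
/-- The pairings `q` such that the loops with at least two pairs formed by `q` and `p`,
respectively by `r` and `q`, are given by `s`, respectively by `t`. -/
noncomputable def middlePairings [Fintype α] (p r : Perm α) (s t : Multiset ℕ) :
    Finset (Perm α) :=
  {q | IsPairing q ∧ (loopType q p).filter (· ≠ 1) = s ∧ (loopType r q).filter (· ≠ 1) = t}

theorem mem_middlePairings [Fintype α] {s t : Multiset ℕ} :
    q ∈ middlePairings p r s t ↔ IsPairing q ∧ (loopType q p).filter (· ≠ 1) = s ∧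
      (loopType r q).filter (· ≠ 1) = t := by
  simp [middlePairings]

theorem card_middlePairings_permCongr [Fintype α] [Fintype β] (e : α ≃ β) (p r : Perm α)
    (s t : Multiset ℕ) :
    (middlePairings (e.permCongr p) (e.permCongr r) s t).card = (middlePairings p r s t).card := by
  symm
  refine Finset.card_bij (fun q _ => e.permCongr q) ?_ ?_ ?_
  · intro q hq
    rw [mem_middlePairings] at hq ⊢
    rw [loopType_permCongr, loopType_permCongr]
    exact ⟨hq.1.permCongr e, hq.2⟩
  · exact fun q _ q' _ h => e.permCongr.injective h
  · intro q hq
    obtain ⟨q, rfl⟩ := e.permCongr.surjective q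
    refine ⟨q, ?_, rfl⟩
    rw [mem_middlePairings] at hq ⊢
    rw [loopType_permCongr, loopType_permCongr] at hq
    refine ⟨?_, hq.2⟩
    simpa [← Equiv.permCongr_symm] using hq.1.permCongr e.symm

/-- The extension of a permutation by the pairing of `(i, false)` with `(i, true)`. -/
def flipExtend (p : Perm α) (ι : Type*) : Perm (α ⊕ ι × Bool) :=
  Equiv.Perm.sumCongr p (flipPerm ι)

theorem IsPairing.flipExtend (hp : IsPairing p) (ι : Type*) : IsPairing (flipExtend p ι) :=
  hp.sumCongr (isPairing_flipPerm ι)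

/-- Splitting off some of the added points. -/
def splitEquiv (α : Type*) {κ μ ι : Type*} (g : κ ⊕ μ ≃ ι) :
    (α ⊕ κ × Bool) ⊕ μ × Bool ≃ α ⊕ ι × Bool :=
  (Equiv.sumAssoc _ _ _).trans (Equiv.sumCongr (Equiv.refl α)
    ((Equiv.sumProdDistrib κ μ Bool).symm.trans (Equiv.prodCongr g (Equiv.refl Bool))))

section

variable {κ μ ι : Type*} (g : κ ⊕ μ ≃ ι)

theorem splitEquiv_permCongr_flipExtend (p : Perm α) :
    (splitEquiv α g).permCongr (flipExtend (flipExtend p κ) μ) = flipExtend p ι := by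
  apply permCongr_eq_of_apply
  rintro ((x | ⟨i, b⟩) | ⟨i, b⟩) <;> rfl

theorem filter_loopType_flipExtend [Fintype α] [Fintype ι] (p q : Perm α) :
    (loopType (flipExtend p ι) (flipExtend q ι)).filter (· ≠ 1) =
      (loopType p q).filter (· ≠ 1) := by
  rw [flipExtend, flipExtend, loopType_sumCongr, Multiset.filter_add, add_eq_left,
    Multiset.filter_eq_nil]
  intro i hi
  simpa using eq_one_of_mem_loopType_self (isPairing_flipPerm ι) hi

/-- A pairing containing all pairs indexed by `μ` preserves the complement of these points, so it
restricts there. -/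
theorem exists_eq_splitEquiv_permCongr [Finite α] [Finite ι] {q : Perm (α ⊕ ι × Bool)}
    (hq : IsPairing q)
    (h : ∀ m : μ, q (Sum.inr (g (Sum.inr m), false)) = Sum.inr (g (Sum.inr m), true)) :
    ∃ q' : Perm (α ⊕ κ × Bool), IsPairing q' ∧
      (splitEquiv α g).permCongr (flipExtend q' μ) = q := by
  have : Finite (κ ⊕ μ) := Finite.of_equiv _ g.symm
  have : Finite κ := Finite.sum_left μ
  have : Finite μ := Finite.sum_right κ
  obtain ⟨Q, rfl⟩ := (splitEquiv α g).permCongr.surjective q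
  have hQ : IsPairing Q := by
    simpa [← Equiv.permCongr_symm] using hq.permCongr (splitEquiv α g).symm
  have h1 (m : μ) : Q (Sum.inr (m, false)) = Sum.inr (m, true) := by
    have := h m
    rwa [show (Sum.inr (g (Sum.inr m), false) : α ⊕ ι × Bool) =
      splitEquiv α g (Sum.inr (m, false)) from rfl,
      show (Sum.inr (g (Sum.inr m), true) : α ⊕ ι × Bool) =
      splitEquiv α g (Sum.inr (m, true)) from rfl, Equiv.permCongr_apply,
      Equiv.symm_apply_apply, Equiv.apply_eq_iff_eq] at this
  have h2 (y : μ × Bool) : Q (Sum.inr y) = Sum.inr (flipPerm μ y) := by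
    obtain ⟨m, _ | _⟩ := y
    · exact h1 m
    · rw [← h1, hQ.apply_apply]
      rfl
  have h3 : Set.MapsTo Q (Set.range Sum.inl) (Set.range Sum.inl) := by
    rintro _ ⟨a, rfl⟩
    rcases hy : Q (Sum.inl a) with b | y
    · exact ⟨b, rfl⟩
    · have := congrArg Q hy
      rw [hQ.apply_apply, h2] at this
      cases this
  obtain ⟨⟨q', q''⟩, rfl⟩ := Equiv.Perm.mem_sumCongrHom_range_of_perm_mapsTo_inl h3
  have h4 : q'' = flipPerm μ := by
    ext1 y
    simpa using h2 y
  subst h4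
  refine ⟨q', ⟨?_, ?_⟩, rfl⟩
  · ext1 x
    have := hQ.apply_apply (Sum.inl x)
    simpa using this
  · intro x hx
    apply hQ.2 (Sum.inl x)
    simp [hx]

open Classical in
/-- The elements of `middlePairings` in which none of the added pairs occurs. -/
noncomputable def spreadPairings [Fintype α] (p r : Perm α) (s t : Multiset ℕ) (ι : Type*)
    [Fintype ι] : Finset (Perm (α ⊕ ι × Bool)) :=
  {q ∈ middlePairings (flipExtend p ι) (flipExtend r ι) s t |
    ∀ i, q (Sum.inr (i, false)) ≠ Sum.inr (i, true)}

theorem mem_spreadPairings [Fintype α] {s t : Multiset ℕ} [Fintype ι]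
    {q : Perm (α ⊕ ι × Bool)} : q ∈ spreadPairings p r s t ι ↔
      q ∈ middlePairings (flipExtend p ι) (flipExtend r ι) s t ∧
        ∀ i, q (Sum.inr (i, false)) ≠ Sum.inr (i, true) := by
  simp [spreadPairings]

-- Adjoining the pairs indexed by `μ` to all three pairings only creates loops of half-size 1, so it
-- is a bijection onto the middle pairings whose added pairs are exactly those of `μ`.
open Classical in
theorem card_spreadPairings_eq [Fintype α] [Fintype κ] [Fintype ι] [Fintype μ] (p r : Perm α)
    (s t : Multiset ℕ) :
    (spreadPairings p r s t κ).card =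
      ({q ∈ middlePairings (flipExtend p ι) (flipExtend r ι) s t |
        ∀ i, q (Sum.inr (g i, false)) = Sum.inr (g i, true) ↔ i.isRight} : Finset _).card := by
  have hmem (q : Perm (α ⊕ κ × Bool)) (hq : IsPairing q) :
      q ∈ middlePairings (flipExtend p κ) (flipExtend r κ) s t ↔
        (splitEquiv α g).permCongr (flipExtend q μ) ∈
          middlePairings (flipExtend p ι) (flipExtend r ι) s t := by
    rw [mem_middlePairings, mem_middlePairings, ← splitEquiv_permCongr_flipExtend g,
      ← splitEquiv_permCongr_flipExtend g, loopType_permCongr, loopType_permCongr,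
      filter_loopType_flipExtend, filter_loopType_flipExtend]
    simp only [hq, (hq.flipExtend μ).permCongr, true_and]
  have hr (q : Perm (α ⊕ κ × Bool)) (m : μ) :
      (splitEquiv α g).permCongr (flipExtend q μ) (Sum.inr (g (Sum.inr m), false)) =
        Sum.inr (g (Sum.inr m), true) := by
    rw [show (Sum.inr (g (Sum.inr m), false) : α ⊕ ι × Bool) =
      splitEquiv α g (Sum.inr (m, false)) from rfl, Equiv.permCongr_apply,
      Equiv.symm_apply_apply]
    rfl
  have hl (q : Perm (α ⊕ κ × Bool)) (k : κ) :
      (splitEquiv α g).permCongr (flipExtend q μ) (Sum.inr (g (Sum.inl k), false)) =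
        Sum.inr (g (Sum.inl k), true) ↔ q (Sum.inr (k, false)) = Sum.inr (k, true) := by
    rw [show (Sum.inr (g (Sum.inl k), false) : α ⊕ ι × Bool) =
      splitEquiv α g (Sum.inl (Sum.inr (k, false))) from rfl,
      show (Sum.inr (g (Sum.inl k), true) : α ⊕ ι × Bool) =
      splitEquiv α g (Sum.inl (Sum.inr (k, true))) from rfl, Equiv.permCongr_apply,
      Equiv.symm_apply_apply, Equiv.apply_eq_iff_eq]
    simp [flipExtend]
  refine Finset.card_bij (fun q _ => (splitEquiv α g).permCongr (flipExtend q μ)) ?_ ?_ ?_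
  · intro q hq
    rw [mem_spreadPairings] at hq
    rw [Finset.mem_filter, ← hmem q (mem_middlePairings.1 hq.1).1]
    refine ⟨hq.1, ?_⟩
    rintro (k | m)
    · rw [hl]
      simpa using hq.2 k
    · simp [hr]
  · intro q _ q' _ h
    have h1 := (splitEquiv α g).permCongr.injective h
    ext1 x
    simpa [flipExtend] using congrArg (fun f => f (Sum.inl x)) h1
  · intro q hq
    rw [Finset.mem_filter] at hq
    obtain ⟨q', hq', rfl⟩ := exists_eq_splitEquiv_permCongr g (mem_middlePairings.1 hq.1).1
      fun m => (hq.2 (Sum.inr m)).2 rfl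
    refine ⟨q', ?_, rfl⟩
    rw [mem_spreadPairings, hmem q' hq']
    refine ⟨hq.1, fun k hk => ?_⟩
    simpa using (hq.2 (Sum.inl k)).1 ((hl q' k).2 hk)

end

theorem card_middlePairings_flipExtend [Fintype α] {ι : Type*} [Fintype ι] (p r : Perm α)
    (s t : Multiset ℕ) :
    (middlePairings (flipExtend p ι) (flipExtend r ι) s t).card =
      ∑ j ∈ Finset.range (Fintype.card ι + 1),
        (Fintype.card ι).choose j * (spreadPairings p r s t (Fin j)).card := by
  classical
  -- The binomial sum becomes a sum over the subsets `S` of added pairs that `q` omits; the fibre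
  -- over `S` depends only on the size of `S`.
  have h1 := Finset.sum_powerset_apply_card (fun j => (spreadPairings p r s t (Fin j)).card)
    (x := (Finset.univ : Finset ι))
  simp only [Finset.card_univ, smul_eq_mul] at h1
  rw [← h1, Finset.powerset_univ, Finset.card_eq_sum_card_fiberwise
    (f := fun q : Perm (α ⊕ ι × Bool) =>
      ({i | q (Sum.inr (i, false)) ≠ Sum.inr (i, true)} : Finset ι))
    (t := Finset.univ) fun _ _ => Finset.mem_univ _]
  refine Finset.sum_congr rfl fun S _ => ?_
  let g : Fin S.card ⊕ {i // i ∉ S} ≃ ι :=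
    (Equiv.sumCongr S.equivFin.symm (Equiv.refl _)).trans (Equiv.sumCompl (· ∈ S))
  rw [card_spreadPairings_eq g]
  congr 1
  ext q
  simp only [Finset.mem_filter, and_congr_right_iff]
  intro _
  have hgl (k) : g (Sum.inl k) ∈ S := (S.equivFin.symm k).2
  have hgr (m) : g (Sum.inr m) ∉ S := m.2
  rw [Finset.ext_iff, ← g.forall_congr_right]
  refine forall_congr' ?_
  rintro (k | m)
  · simp [hgl]
  · simp [hgr]

theorem two_mul_card_loopType_add [Fintype α] (hp : IsPairing p) (hq : IsPairing q) :
    2 * Multiset.card (loopType p q) + 2 * ((loopType p q).filter (· ≠ 1)).sum =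
      Fintype.card α + 2 * Multiset.card ((loopType p q).filter (· ≠ 1)) := by
  have h1 := sum_add_card_filter_ne_one (loopType p q)
  have h2 := two_mul_sum_loopType hp hq
  omega

/-- For `q` in the set, every point is a disagreement of `q` with one of the two extended pairings:
on `α` because they differ from each other, on the added points by spreading. Counting disagreements
gives the first bound. The second is the triangle inequality, in which all `2 * j` added points are
counted. -/
theorem spreadPairings_bounds [Fintype α] (hp : IsPairing p) (hr : IsPairing r)
    (hpr : ∀ i ∈ loopType p r, 2 ≤ i) {s t : Multiset ℕ} {j : ℕ}
    (h : (spreadPairings p r s t (Fin j)).card ≠ 0) :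
    (loopType p r).sum + j ≤ s.sum + t.sum ∧
      (loopType p r).sum + j + Multiset.card s + Multiset.card t ≤
        s.sum + t.sum + Multiset.card (loopType p r) := by
  classical
  obtain ⟨q, hq₀⟩ := Finset.card_ne_zero.1 h
  obtain ⟨hq', hj⟩ := mem_spreadPairings.1 hq₀
  obtain ⟨hq, rfl, rfl⟩ := mem_middlePairings.1 hq'
  have hP := hp.flipExtend (Fin j)
  have hR := hr.flipExtend (Fin j)
  have hcard : Fintype.card (α ⊕ Fin j × Bool) = 2 * (loopType p r).sum + 2 * j := by
    rw [two_mul_sum_loopType hp hr]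
    simp [mul_comm]
  have hne (x : Fin j × Bool) : q (Sum.inr x) ≠ Sum.inr (flipPerm _ x) := by
    obtain ⟨i, _ | _⟩ := x
    · exact hj i
    · intro hx
      apply hj i
      have := congrArg q hx
      rw [hq.apply_apply] at this
      exact this.symm
  have hne' (x : α) : p x ≠ r x := by
    intro hx
    have := hpr _ ((mem_loopType hp hr).2 ⟨x, rfl⟩)
    rw [(minimalPeriod_eq_one_iff hr).2 hx] at this
    omega
  constructor
  · have h1 := two_mul_sum_filter_ne_one_loopType hq hP
    have h2 := two_mul_sum_filter_ne_one_loopType hR hq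
    have h3 : (Finset.univ : Finset (α ⊕ Fin j × Bool)) ⊆
        ({x | q x ≠ flipExtend p _ x} : Finset _) ∪ ({x | flipExtend r _ x ≠ q x} : Finset _) := by
      rintro (x | x) -
      · rw [Finset.mem_union, Finset.mem_filter, Finset.mem_filter, or_iff_not_imp_left]
        refine fun hx => ⟨Finset.mem_univ _, fun hx' => hne' x ?_⟩
        have hx : q (Sum.inl x) = flipExtend p _ (Sum.inl x) := by simpa using hx
        exact Sum.inl_injective (hx.symm.trans hx'.symm)
      · simpa [flipExtend] using Or.inl (hne x)
    have h4 := (Finset.card_le_card h3).trans (Finset.card_union_le _ _)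
    rw [Finset.card_univ, hcard] at h4
    omega
  · have h1 := card_loopType_add_card_loopType_le hP hq hR
    have h2 : Fintype.card (Fin j × Bool) ≤ ({x | flipExtend p (Fin j) x = flipExtend r _ x ∧
        flipExtend p _ x ≠ q x} : Finset _).card := by
      rw [← Finset.card_univ, ← Finset.card_image_of_injective _ (Sum.inr_injective (α := α))]
      refine Finset.card_le_card ?_
      simp only [Finset.subset_iff, Finset.mem_image, Finset.mem_univ, true_and,
        Finset.mem_filter]
      rintro _ ⟨x, rfl⟩
      exact ⟨rfl, (hne x).symm⟩
    have h3 := two_mul_card_loopType_add hq hP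
    have h4 := two_mul_card_loopType_add hR hq
    have h5 := two_mul_card_loopType_add hP hR
    rw [filter_loopType_flipExtend, Multiset.filter_eq_self.2
      fun i hi => ne_of_gt (hpr i hi)] at h5
    rw [loopType_comm _ q, loopType_comm q (flipExtend r _)] at h1
    rw [Fintype.card_prod, Fintype.card_fin, Fintype.card_bool] at h2
    rw [hcard] at h1 h3 h4 h5
    omega

end

/-! ### Conjugacy and centralizers of pairings -/

section

variable {α β : Type*} {p q : Perm α}

theorem loopType_self [Fintype α] (hp : IsPairing p) {n : ℕ} (h : Fintype.card α = 2 * n) :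
    loopType p p = Multiset.replicate n 1 := by
  have h1 := Multiset.eq_replicate_card.2 fun i (hi : i ∈ loopType p p) =>
    eq_one_of_mem_loopType_self hp hi
  have h2 := two_mul_sum_loopType hp hp
  rw [h1, Multiset.sum_replicate, smul_eq_mul, mul_one, h] at h2
  rw [h1, show Multiset.card (loopType p p) = n by omega]

theorem exists_permCongr_eq [Fintype α] [Fintype β] {q : Perm β} (hp : IsPairing p)
    (hq : IsPairing q) (h : Fintype.card α = Fintype.card β) :
    ∃ e : α ≃ β, e.permCongr p = q := by
  have hn := two_mul_sum_loopType hp hp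
  obtain ⟨e, he, -⟩ := exists_permCongr_of_loopType_eq hp hp hq hq
    ((loopType_self hp hn.symm).trans (loopType_self hq (h.symm.trans hn.symm)).symm)
  exact ⟨e, he⟩

theorem nat_card_centralizer_of_isPairing [Fintype α] [DecidableEq α] (hp : IsPairing p) {n : ℕ}
    (h : Fintype.card α = 2 * n) :
    Nat.card (Subgroup.centralizer {p}) = 2 ^ n * n.factorial := by
  have h1 : p.cycleType = Multiset.replicate (Multiset.card p.cycleType) 2 := by
    rw [Multiset.eq_replicate_card]
    intro i hi
    have h2 : i ∣ 2 := (Equiv.Perm.dvd_of_mem_cycleType hi).trans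
      (orderOf_dvd_of_pow_eq_one (by rw [pow_two, hp.1]))
    exact le_antisymm (Nat.le_of_dvd two_pos h2) (Equiv.Perm.two_le_of_mem_cycleType hi)
  have h2 := p.sum_cycleType
  have h3 : p.support = Finset.univ := by
    ext x
    simp [hp.2]
  rw [h3, Finset.card_univ, h, h1, Multiset.sum_replicate, smul_eq_mul] at h2
  rw [show Multiset.card p.cycleType = n by omega] at h1
  rw [Equiv.Perm.nat_card_centralizer, h1, h, Multiset.sum_replicate, Multiset.prod_replicate,
    smul_eq_mul, mul_comm n 2, Nat.sub_self, Nat.factorial_zero, one_mul]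
  congr 1
  rcases n.eq_zero_or_pos with rfl | hn
  · simp
  · simp [Multiset.toFinset_replicate, hn.ne']

/-- Pairings are all conjugate, so each fibre of `a ↦ a * p * a⁻¹` over `S` is a left coset of the
centralizer of `p`. -/
theorem card_filter_conj_mem [Fintype α] [DecidableEq α] (hp : IsPairing p) {n : ℕ}
    (h : Fintype.card α = 2 * n) {S : Finset (Perm α)} (hS : ∀ q ∈ S, IsPairing q) :
    ({a | a * p * a⁻¹ ∈ S} : Finset (Perm α)).card = 2 ^ n * n.factorial * S.card := by
  classical
  rw [Finset.card_eq_sum_card_fiberwise (f := fun a => a * p * a⁻¹) (t := S)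
    (fun a ha => by simpa using ha), mul_comm, ← smul_eq_mul, ← Finset.sum_const]
  refine Finset.sum_congr rfl fun q hq => ?_
  obtain ⟨g, hg⟩ : ∃ g : Perm α, g * p * g⁻¹ = q := exists_permCongr_eq hp (hS q hq) rfl
  rw [← nat_card_centralizer_of_isPairing hp h, Nat.card_eq_fintype_card, Fintype.card_subtype]
  symm
  refine Finset.card_bij (fun c _ => g * c) ?_ (fun c _ d _ hcd => mul_left_cancel hcd) ?_
  · intro c hc
    rw [Finset.mem_filter, Subgroup.mem_centralizer_singleton_iff] at hc
    have h1 : g * c * p * (g * c)⁻¹ = q := by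
      rw [mul_inv_rev, mul_assoc g, hc.2, ← hg]
      group
    rw [Finset.mem_filter, Finset.mem_filter]
    exact ⟨⟨Finset.mem_univ _, h1 ▸ hq⟩, h1⟩
  · intro a ha
    refine ⟨g⁻¹ * a, ?_, mul_inv_cancel_left g a⟩
    rw [Finset.mem_filter, Subgroup.mem_centralizer_singleton_iff]
    refine ⟨Finset.mem_univ _, ?_⟩
    have h1 := (Finset.mem_filter.1 ha).2
    rw [← hg, mul_inv_eq_iff_eq_mul] at h1
    rw [mul_assoc, h1]
    group

end

/-! ### Coset-types as loop types -/

/-- The pairing of `2k` with `2k + 1`. -/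
def basePairing (n : ℕ) : Perm (Fin (2 * n)) :=
  Function.Involutive.toPerm
    (fun i => ⟨if (i : ℕ) % 2 = 0 then i + 1 else i - 1, by have := i.2; split_ifs <;> omega⟩)
    (fun i => by ext; dsimp only; split_ifs <;> omega)

theorem basePairing_apply_val {n : ℕ} (i : Fin (2 * n)) :
    (basePairing n i : ℕ) = if (i : ℕ) % 2 = 0 then (i : ℕ) + 1 else i - 1 := rfl

theorem div_two_eq_iff {n : ℕ} (i j : Fin (2 * n)) :
    (i : ℕ) / 2 = (j : ℕ) / 2 ↔ i = j ∨ basePairing n i = j := by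
  rw [Fin.ext_iff, Fin.ext_iff, basePairing_apply_val]
  split_ifs <;> omega

theorem isPairing_basePairing (n : ℕ) : IsPairing (basePairing n) := by
  constructor
  · ext i
    rw [Equiv.Perm.mul_apply, basePairing_apply_val, basePairing_apply_val, Equiv.Perm.one_apply]
    split_ifs <;> omega
  · intro i h
    have := congrArg Fin.val h
    rw [basePairing_apply_val] at this
    split_ifs at this <;> omega

theorem cosetGraph_eq {n : ℕ} (ω : Perm (Fin (2 * n))) :
    cosetGraph ω = pairGraph (basePairing n) (ω⁻¹ * basePairing n * ω) := by
  ext i j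
  rw [pairGraph, SimpleGraph.fromRel_adj]
  have h1 : basePairing n i = j ↔ basePairing n j = i := by
    constructor <;> rintro rfl <;> exact (isPairing_basePairing n).apply_apply _
  have h2 : basePairing n (ω i) = ω j ↔ basePairing n (ω j) = ω i := by
    constructor <;> intro h <;> rw [← h] <;> exact (isPairing_basePairing n).apply_apply _
  simp only [cosetGraph, div_two_eq_iff, Equiv.Perm.mul_apply, Equiv.Perm.inv_eq_iff_eq,
    EmbeddingLike.apply_eq_iff_eq, ← h1, eq_comm (b := ω j), ← h2, or_self]
  tauto

theorem cosetType_eq {n : ℕ} (ω : Perm (Fin (2 * n))) :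
    cosetType ω = loopType (ω * basePairing n * ω⁻¹) (basePairing n) := by
  have h : cosetType ω = loopType (basePairing n) (ω⁻¹ * basePairing n * ω) := by
    have key (G H : SimpleGraph (Fin (2 * n))) (hGH : G = H) [Fintype G.ConnectedComponent]
        [Fintype H.ConnectedComponent] :
        (Finset.univ : Finset G.ConnectedComponent).val.map (fun C => C.supp.ncard / 2) =
          (Finset.univ : Finset H.ConnectedComponent).val.map fun C => C.supp.ncard / 2 := by
      subst hGH
      congr!
    rw [cosetType, loopType]
    convert key _ _ (cosetGraph_eq ω)
  rw [h, ← loopType_conj ω]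
  congr 1
  group

theorem sum_cosetType {n : ℕ} (ω : Perm (Fin (2 * n))) : (cosetType ω).sum = n := by
  have := two_mul_sum_loopType ((isPairing_basePairing n).conj ω) (isPairing_basePairing n)
  rw [Fintype.card_fin, ← cosetType_eq] at this
  omega

/-- The parts of the coset-type other than `1`. -/
noncomputable def properType {n : ℕ} (ω : Perm (Fin (2 * n))) : ProperPartition where
  parts := (cosetType ω).filter (· ≠ 1)
  two_le i hi := by
    rw [Multiset.mem_filter, cosetType_eq] at hi
    have := pos_of_mem_loopType ((isPairing_basePairing n).conj ω) (isPairing_basePairing n) hi.1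
    have := hi.2
    omega

theorem properType_eq_iff {n : ℕ} {lam : ProperPartition} {ω : Perm (Fin (2 * n))} :
    properType ω = lam ↔ (cosetType ω).filter (· ≠ 1) = lam.parts := ProperPartition.ext_iff

theorem ProperPartition.filter_ne_one (rho : ProperPartition) :
    rho.parts.filter (· ≠ 1) = rho.parts :=
  Multiset.filter_eq_self.2 fun i hi => ne_of_gt (rho.two_le i hi)

theorem size_properType_le {n : ℕ} (ω : Perm (Fin (2 * n))) : (properType ω).size ≤ n := by
  have h := sum_cosetType ω
  rw [← Multiset.filter_add_not (· ≠ 1) (cosetType ω), Multiset.sum_add] at h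
  exact le_of_add_le_left h.le

/-- The number of ones is recovered from the sum `n`. The truncated subtraction is harmless: if
`lam.size > n`, both sides are false. -/
theorem cosetType_eq_iff {n : ℕ} (lam : ProperPartition) (ω : Perm (Fin (2 * n))) :
    cosetType ω = lam.parts + Multiset.replicate (n - lam.size) 1 ↔ properType ω = lam := by
  rw [properType_eq_iff]
  constructor
  · intro h
    rw [h, Multiset.filter_add, lam.filter_ne_one, add_eq_left, Multiset.filter_eq_nil]
    exact fun i hi => not_not.2 (Multiset.eq_of_mem_replicate hi)
  · intro h
    have h1 := Multiset.filter_add_not (· ≠ 1) (cosetType ω)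
    have h2 : (cosetType ω).filter (fun a => ¬ a ≠ 1) =
        Multiset.replicate (Multiset.card ((cosetType ω).filter (fun a => ¬ a ≠ 1))) 1 :=
      Multiset.eq_replicate_card.2 fun i hi => not_not.1 (Multiset.mem_filter.1 hi).2
    have h3 := sum_cosetType ω
    rw [h, h2] at h1
    rw [← h1, Multiset.sum_add, Multiset.sum_replicate, smul_eq_mul, mul_one,
      ← ProperPartition.size] at h3
    rw [← h1, Nat.eq_sub_of_add_eq' h3]

theorem exists_properType_eq {n : ℕ} {rho : ProperPartition} (h : rho.size ≤ n) :
    ∃ ω : Perm (Fin (2 * n)), properType ω = rho := by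
  obtain ⟨α, _, p, q, hp, hq, hpq⟩ :=
    exists_loopType_eq (rho.parts + Multiset.replicate (n - rho.size) 1) (by
      intro i hi
      rcases Multiset.mem_add.1 hi with hi | hi
      · exact two_pos.trans_le (rho.two_le i hi)
      · rw [Multiset.eq_of_mem_replicate hi]
        exact one_pos)
  have hcard := two_mul_sum_loopType hp hq
  rw [hpq, Multiset.sum_add, ← ProperPartition.size, Multiset.sum_replicate, smul_eq_mul, mul_one,
    Nat.add_sub_cancel' h] at hcard
  obtain ⟨e, he⟩ := exists_permCongr_eq hq (isPairing_basePairing n)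
    (by rw [← hcard, Fintype.card_fin])
  obtain ⟨ω, hω⟩ : ∃ ω : Perm (Fin (2 * n)), ω * basePairing n * ω⁻¹ = e.permCongr p :=
    exists_permCongr_eq (isPairing_basePairing n) (hp.permCongr e) rfl
  refine ⟨ω, ?_⟩
  rw [← cosetType_eq_iff, cosetType_eq, hω, ← he, loopType_permCongr, hpq]

/-! ### Coefficients of products in the group algebra -/

theorem coeff_heckeK {n : ℕ} (lam : ProperPartition) (ω : Perm (Fin (2 * n)))
    [Decidable (properType ω = lam)] :
    (heckeK n lam).coeff ω = if properType ω = lam then 1 else 0 := by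
  classical
  simp [heckeK, cosetType_eq_iff, MonoidAlgebra.coeff_sum, Finsupp.finsetSum_apply,
    Finsupp.single_apply]

open Classical in
theorem coeff_heckeK_mul {n : ℕ} (lam del : ProperPartition) (ω : Perm (Fin (2 * n))) :
    (heckeK n lam * heckeK n del).coeff ω =
      (({a | properType a = lam ∧ properType (a⁻¹ * ω) = del} :
        Finset (Perm (Fin (2 * n)))).card : ℂ) := by
  have h (a b : Perm (Fin (2 * n))) : a * b = ω ↔ b = a⁻¹ * ω := eq_inv_mul_iff_mul_eq.symm
  simp only [heckeK, cosetType_eq_iff, Finset.sum_mul_sum,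
    MonoidAlgebra.coeff_sum, Finsupp.finsetSum_apply, MonoidAlgebra.of_apply,
    MonoidAlgebra.single_mul_single, one_mul,
    MonoidAlgebra.coeff_single, Finsupp.single_apply, h, Finset.sum_ite_eq', Finset.mem_filter,
    Finset.mem_univ, true_and]
  rw [← Finset.sum_filter, Finset.filter_filter, Finset.sum_const, nsmul_eq_mul, mul_one]

/-- The conditions on `a` see only the pairing `a * basePairing n * a⁻¹`: conjugation by `a` turns
the loops of `a⁻¹ * ω` into loops formed with that pairing. -/
theorem coeff_heckeK_mul_eq_card_middlePairings {n : ℕ} (lam del : ProperPartition)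
    (ω : Perm (Fin (2 * n))) :
    (heckeK n lam * heckeK n del).coeff ω = 2 ^ n * (n.factorial : ℂ) *
      (middlePairings (basePairing n) (ω * basePairing n * ω⁻¹) lam.parts del.parts).card := by
  classical
  rw [coeff_heckeK_mul]
  have h := card_filter_conj_mem (isPairing_basePairing n) (Fintype.card_fin (2 * n))
    (S := middlePairings (basePairing n) (ω * basePairing n * ω⁻¹) lam.parts del.parts)
    fun q hq => (mem_middlePairings.1 hq).1
  have h' := congrArg (Nat.cast : ℕ → ℂ) h
  push_cast at h'
  rw [← h']
  congr 2
  ext a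
  rw [Finset.mem_filter, Finset.mem_filter, mem_middlePairings, properType_eq_iff,
    properType_eq_iff, cosetType_eq, cosetType_eq,
    ← loopType_conj a (a⁻¹ * ω * basePairing n * (a⁻¹ * ω)⁻¹)]
  have h1 : a * (a⁻¹ * ω * basePairing n * (a⁻¹ * ω)⁻¹) * a⁻¹ = ω * basePairing n * ω⁻¹ := by
    group
  simp only [h1, (isPairing_basePairing n).conj a, Finset.mem_univ, true_and]

/-- The coefficients of a product of two `K`s, expanded in binomial coefficients. -/
theorem exists_binomial_expansion (lam del rho : ProperPartition) :
    ∃ c : ℕ → ℕ,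
      (∀ j, c j ≠ 0 → rho.size + j ≤ lam.size + del.size ∧
        rho.size + j + lam.length + del.length ≤ lam.size + del.size + rho.length) ∧
      ∀ (n : ℕ) (ω : Perm (Fin (2 * n))), properType ω = rho →
        (heckeK n lam * heckeK n del).coeff ω = 2 ^ n * (n.factorial : ℂ) *
          ((∑ j ∈ Finset.range (n - rho.size + 1), (n - rho.size).choose j * c j : ℕ) : ℂ) := by
  -- A model of type `rho` on `2 * rho.size` points, chosen before `n`, so that `c` does not depend
  -- on `n`.
  obtain ⟨α, _, p, r, hp, hr, hpr⟩ :=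
    exists_loopType_eq rho.parts fun i hi => two_pos.trans_le (rho.two_le i hi)
  refine ⟨fun j => (spreadPairings p r lam.parts del.parts (Fin j)).card, ?_, ?_⟩
  · intro j hj
    have := spreadPairings_bounds hp hr (hpr ▸ rho.two_le) hj
    rwa [hpr] at this
  · intro n ω hω
    rw [coeff_heckeK_mul_eq_card_middlePairings]
    have h1 := (cosetType_eq_iff rho ω).2 hω
    rw [cosetType_eq, loopType_comm] at h1
    have h2 : loopType (flipExtend p (Fin (n - rho.size))) (flipExtend r (Fin (n - rho.size))) =
        rho.parts + Multiset.replicate (n - rho.size) 1 := by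
      rw [flipExtend, flipExtend, loopType_sumCongr, hpr,
        loopType_self (isPairing_flipPerm _) (n := n - rho.size) (by simp [mul_comm])]
    obtain ⟨e, he, he'⟩ := exists_permCongr_of_loopType_eq (hp.flipExtend _) (hr.flipExtend _)
      (isPairing_basePairing n) ((isPairing_basePairing n).conj ω) (h2.trans h1.symm)
    rw [← he', ← he, card_middlePairings_permCongr, card_middlePairings_flipExtend,
      Fintype.card_fin]

theorem coeff_sum_smul_heckeK {n : ℕ} (c : ProperPartition →₀ ℂ) (ω : Perm (Fin (2 * n))) :
    (c.sum fun rho a => a • heckeK n rho).coeff ω = c (properType ω) := by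
  classical
  simp [Finsupp.sum, MonoidAlgebra.coeff_sum, Finsupp.finsetSum_apply, coeff_heckeK,
    eq_comm (a := (0 : ℂ))]

theorem isProductExpansion_iff {lam del : ProperPartition} {n : ℕ} {c : ProperPartition →₀ ℂ} :
    IsProductExpansion lam del n c ↔ (∀ rho ∈ c.support, rho.size ≤ n) ∧
      ∀ ω : Perm (Fin (2 * n)), (heckeK n lam * heckeK n del).coeff ω = c (properType ω) := by
  rw [IsProductExpansion, ← MonoidAlgebra.coeff_inj, Finsupp.ext_iff]
  simp only [coeff_sum_smul_heckeK]

theorem existsUnique_isProductExpansion (lam del : ProperPartition) (n : ℕ) :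
    ∃! c : ProperPartition →₀ ℂ, IsProductExpansion lam del n c := by
  classical
  -- The binomial expansion involves only `n` and the type, so the product is constant on each type.
  have hconst (ω ω' : Perm (Fin (2 * n))) (h : properType ω = properType ω') :
      (heckeK n lam * heckeK n del).coeff ω = (heckeK n lam * heckeK n del).coeff ω' := by
    obtain ⟨c, -, hc⟩ := exists_binomial_expansion lam del (properType ω')
    rw [hc n ω h, hc n ω' rfl]
  let F (rho : ProperPartition) : ℂ :=
    if h : ∃ ω : Perm (Fin (2 * n)), properType ω = rho then
      (heckeK n lam * heckeK n del).coeff h.choose else 0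
  have hF (rho) (h : F rho ≠ 0) : ∃ ω : Perm (Fin (2 * n)), properType ω = rho := by
    by_contra h'
    exact h (dif_neg h')
  let c : ProperPartition →₀ ℂ :=
    Finsupp.onFinset (Finset.univ.image (properType (n := n))) F fun rho h => by
      simpa using hF rho h
  refine ⟨c, isProductExpansion_iff.2 ⟨?_, ?_⟩, ?_⟩
  · intro rho h
    obtain ⟨ω, rfl⟩ := hF rho (Finsupp.mem_support_iff.1 h)
    exact size_properType_le ω
  · intro ω
    have h : ∃ ω' : Perm (Fin (2 * n)), properType ω' = properType ω := ⟨ω, rfl⟩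
    change _ = F (properType ω)
    rw [show F (properType ω) = _ from dif_pos h]
    exact hconst _ _ h.choose_spec.symm
  · intro d hd
    rw [isProductExpansion_iff] at hd
    ext rho
    by_cases h : rho.size ≤ n
    · obtain ⟨ω, rfl⟩ := exists_properType_eq h
      rw [← hd.2]
      have hω : ∃ ω' : Perm (Fin (2 * n)), properType ω' = properType ω := ⟨ω, rfl⟩
      change _ = F (properType ω)
      rw [show F (properType ω) = _ from dif_pos hω]
      exact hconst _ _ hω.choose_spec.symm
    · have h1 : d rho = 0 := by
        by_contra h'
        exact h (hd.1 rho (Finsupp.mem_support_iff.2 h'))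
      have h2 : F rho = 0 := by
        by_contra h'
        obtain ⟨ω, rfl⟩ := hF rho h'
        exact h (size_properType_le ω)
      exact h1.trans h2.symm

theorem structureCoeff_properType (lam del : ProperPartition) {n : ℕ} (ω : Perm (Fin (2 * n))) :
    structureCoeff lam del n (properType ω) = (heckeK n lam * heckeK n del).coeff ω :=
  ((isProductExpansion_iff.1
    (Classical.epsilon_spec (existsUnique_isProductExpansion lam del n).exists)).2 ω).symm

/-! ### The structure polynomial -/

theorem isStructurePolynomial_unique {lam del rho : ProperPartition} {f g : ℚ[X]}
    (hf : IsStructurePolynomial lam del rho f) (hg : IsStructurePolynomial lam del rho g) :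
    f = g := by
  refine Polynomial.eq_of_infinite_eval_eq f g ?_
  refine Set.Infinite.mono ?_ ((Set.Ici_infinite (lam.size + del.size + rho.size)).image
    (Nat.cast_injective (R := ℚ)).injOn)
  rintro _ ⟨n, hn, rfl⟩
  have hn : lam.size + del.size + rho.size ≤ n := hn
  have h1 := hf.1 n (by omega) (by omega) (by omega)
  rw [hg.1 n (by omega) (by omega) (by omega)] at h1
  have h2 : (2 : ℂ) ^ n * (n.factorial : ℂ) ≠ 0 :=
    mul_ne_zero (pow_ne_zero _ two_ne_zero) (Nat.cast_ne_zero.2 n.factorial_ne_zero)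
  exact_mod_cast (mul_left_cancel₀ h2 h1).symm

theorem eval_descPochhammer_comp {n k : ℕ} (h : k ≤ n) (j : ℕ) :
    ((descPochhammer ℚ j).comp (X - C (k : ℚ))).eval (n : ℚ) =
      (j.factorial : ℚ) * ((n - k).choose j : ℚ) := by
  rw [eval_comp, eval_sub, eval_X, eval_C, ← Nat.cast_sub h,
    descPochhammer_eval_eq_descFactorial, Nat.descFactorial_eq_factorial_mul_choose, Nat.cast_mul]

theorem exists_isStructurePolynomial (lam del rho : ProperPartition) :
    ∃ f : ℚ[X], IsStructurePolynomial lam del rho f ∧ (f ≠ 0 →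
      (f.natDegree : ℤ) ≤ (lam.size : ℤ) + del.size - rho.size ∧
      (f.natDegree : ℤ) ≤
        (lam.size : ℤ) + del.size - rho.size - lam.length - del.length + rho.length) := by
  obtain ⟨c, hc, hexp⟩ := exists_binomial_expansion lam del rho
  -- The division turns falling factorials into binomial coefficients.
  let a (j : ℕ) : ℚ := c j / j.factorial
  have ha {j : ℕ} (h : a j ≠ 0) : c j ≠ 0 := by
    rintro h'
    simp [a, h'] at h
  let g (j : ℕ) : ℚ[X] := C (a j) * (descPochhammer ℚ j).comp (X - C (rho.size : ℚ))
  refine ⟨∑ j ∈ Finset.range (lam.size + del.size + 1 - rho.size), g j, ⟨?_, a, ?_, rfl⟩, ?_⟩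
  · intro n _ _ hn
    obtain ⟨ω, rfl⟩ := exists_properType_eq hn
    rw [structureCoeff_properType, hexp n ω rfl]
    congr 1
    rw [← Rat.cast_natCast]
    congr 1
    have hterm (j : ℕ) : (g j).eval (n : ℚ) = ((n - (properType ω).size).choose j * c j : ℕ) := by
      simp only [g, a]
      rw [eval_mul, eval_C, eval_descPochhammer_comp hn]
      have : (j.factorial : ℚ) ≠ 0 := Nat.cast_ne_zero.2 j.factorial_ne_zero
      push_cast
      field_simp
    rw [eval_finsetSum, Finset.sum_congr rfl fun j _ => hterm j, ← Nat.cast_sum]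
    congr 1
    set m := n - (properType ω).size
    set D := lam.size + del.size + 1 - (properType ω).size with hD
    -- Both sums extend to the longer range: the binomial coefficient vanishes for `j > m`, and `c
    -- j` vanishes for `j ≥ D`.
    rw [Finset.sum_subset (Finset.range_mono (le_max_left (m + 1) D)),
      Finset.sum_subset (Finset.range_mono (le_max_right (m + 1) D))]
    · intro j _ hj
      by_contra h
      have := (hc j (right_ne_zero_of_mul h)).1
      rw [Finset.mem_range] at hj
      omega
    · intro j _ hj
      rw [Finset.mem_range] at hj
      rw [Nat.choose_eq_zero_of_lt (by omega), zero_mul]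
  · exact fun j => by positivity
  · intro hf
    have hg {j : ℕ} (h : g j ≠ 0) : c j ≠ 0 := ha fun h' => h (by simp [g, h'])
    have hdeg (j : ℕ) : (g j).natDegree ≤ j := by
      refine (natDegree_C_mul_le _ _).trans (natDegree_comp_le.trans ?_)
      rw [natDegree_X_sub_C, mul_one, descPochhammer_natDegree]
    have hbound (B : ℤ) (hB : ∀ j, c j ≠ 0 → (j : ℤ) ≤ B) :
        ((∑ j ∈ Finset.range (lam.size + del.size + 1 - rho.size), g j).natDegree : ℤ) ≤ B := by
      obtain ⟨i, -, hi⟩ := Finset.exists_ne_zero_of_sum_ne_zero hf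
      -- A nonzero term forces `B` to be nonnegative, so `B.toNat` loses nothing.
      have hB0 : 0 ≤ B := (Int.natCast_nonneg i).trans (hB i (hg hi))
      have h1 := natDegree_sum_le_of_forall_le (Finset.range (lam.size + del.size + 1 - rho.size)) g
        (n := B.toNat) fun j _ => by
          by_cases h : g j = 0
          · simp [h]
          · have := hB j (hg h)
            have := hdeg j
            omega
      omega
    constructor
    · refine hbound _ fun j hj => ?_
      have := (hc j hj).1
      omega
    · refine hbound _ fun j hj => ?_
      have := (hc j hj).2
      omega

theorem mainTheorem4 (lam del rho : ProperPartition) :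
    (∀ n : ℕ, lam.size ≤ n → del.size ≤ n →
      ∃! c : ProperPartition →₀ ℂ, IsProductExpansion lam del n c) ∧
    (∃! f : ℚ[X], IsStructurePolynomial lam del rho f) ∧
    ∀ f : ℚ[X], IsStructurePolynomial lam del rho f → f ≠ 0 →
      (f.natDegree : ℤ) ≤ (lam.size : ℤ) + del.size - rho.size ∧
      (f.natDegree : ℤ) ≤
        (lam.size : ℤ) + del.size - rho.size - lam.length - del.length + rho.length := by
  obtain ⟨f, hf, hdeg⟩ := exists_isStructurePolynomial lam del rho
  refine ⟨fun n _ _ => existsUnique_isProductExpansion lam del n,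
    ⟨f, hf, fun g hg => isStructurePolynomial_unique hg hf⟩, fun g hg => ?_⟩
  rw [isStructurePolynomial_unique hg hf]
  exact hdeg
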